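/- Theorem 3.1. Every finite tree is 7-cordial. That is, for every finite tree $T$ there is a vertex labeling $f : V(T) \to \mathbb{Z}_7$ such that, writing $v_a$ for the number of vertices $u$ of $T$ with $f(u) = a$ and $e_a$ for the number of edges $uv$ of $T$ with $f(u) + f(v) = a$ in $\mathbb{Z}_7$, we have $|v_a - v_b| \le 1$ and $|e_a - e_b| \le 1$ for all $a, b \in \mathbb{Z}_7$. -/

import Mathlib

/-- The weight `f u + f v` in `ℤ/k` that a vertex labeling `f` induces on the edge `s(u, v)`. -/
def edgeWeight {V : Type*} {k : ℕ} (f : V → ZMod k) : Sym2 V → ZMod k :=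
  Sym2.lift ⟨fun u v => f u + f v, fun u v => add_comm (f u) (f v)⟩

/-- The number of vertices with label `a`. -/
noncomputable def vertexCount {V : Type*} {k : ℕ} (f : V → ZMod k) (a : ZMod k) : ℕ :=
  {v : V | f v = a}.ncard

/-- The number of edges with induced weight `a`. -/
noncomputable def edgeCount {V : Type*} {k : ℕ} (G : SimpleGraph V) (f : V → ZMod k)
    (a : ZMod k) : ℕ :=
  {e : Sym2 V | e ∈ G.edgeSet ∧ edgeWeight f e = a}.ncard

/-- `f` is a `k`-cordial labeling of the finite graph `G` (for `k > 0`): any two label counts, and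
any two edge-weight counts, differ by at most one. -/
structure IsCordialLabeling {V : Type*} [Finite V] {k : ℕ} [NeZero k] (G : SimpleGraph V)
    (f : V → ZMod k) : Prop where
  vertex : ∀ a b : ZMod k, |(vertexCount f a : ℤ) - (vertexCount f b : ℤ)| ≤ 1
  edge : ∀ a b : ZMod k, |(edgeCount G f a : ℤ) - (edgeCount G f b : ℤ)| ≤ 1

/-- A finite graph is `k`-cordial if it has a `k`-cordial labeling. -/
def IsCordial {V : Type*} [Finite V] (k : ℕ) [NeZero k] (G : SimpleGraph V) : Prop :=
  ∃ f : V → ZMod k, IsCordialLabeling G f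

/-! Root the tree at a vertex labeled 0. Every other vertex carries the edge to its parent, so a
rooted forest hangs below the root, with as many edges as vertices. Suppose seven vertices can be
removed and put back, whatever the labels of the vertices they hang from, so that each label and
each weight is gained exactly once. Then a balanced labeling of the rest extends to a balanced
labeling of the whole, and induction on the size applies (`Reducible`, `exists_balanced`).

The seven vertices may hang from one vertex (`Full`) or from two (`Full₂`). Affine maps of ℤ/7
permute labels and weights, so each condition is a finite search with attaching labels 0, or 0, 0
and 0, 1. A case analysis on the size of the largest tree finds such pieces, apart from four forests
of seven vertices (`exceptional`).

Three of these, put under a new root, can replace a leaf: its label and weight reappear somewhere in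
the new piece (`Replaces`). The fourth, put under a new root, is `doubleStar`; it replaces a leaf
whose label differs from that of its parent, and the remaining case is settled by relabeling it
together with a neighboring piece. By `reducible_or_exceptional`, only the four forests and
`doubleStar` itself remain among forests with at least seven vertices. These, and all smaller
forests, are labeled directly. -/

/-- Ordered rooted forests, in first-child/next-sibling form: `cons C R` has a first root whose
subtrees form the forest `C`, and the remaining trees form `R`. -/
inductive PlaneForest
  | nil : PlaneForest
  | cons (C R : PlaneForest) : PlaneForest
  deriving DecidableEq

/-! ### Labelings of plane forests and their affine symmetry. -/

namespace PlaneForest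

/-- The number of vertices. -/
def size : PlaneForest → ℕ
  | nil => 0
  | cons C R => 1 + size C + size R

/-- The disjoint union. -/
def append : PlaneForest → PlaneForest → PlaneForest
  | nil, G => G
  | cons C R, G => cons C (append R G)

/-- `n` isolated roots. -/
def leaves : ℕ → PlaneForest
  | 0 => nil
  | n + 1 => cons nil (leaves n)

/-- All residues modulo seven, once each. -/
abbrev allResidues : Multiset (ZMod 7) := (Finset.univ : Finset (ZMod 7)).val

/-- `Labels F x M E`: if the roots of `F` are attached to a vertex with label `x`, then `F` has a
labeling in which `M` is the multiset of labels and `E` the multiset of edge weights. -/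
inductive Labels : PlaneForest → ZMod 7 → Multiset (ZMod 7) → Multiset (ZMod 7) → Prop
  | nil (x : ZMod 7) : Labels nil x 0 0
  | cons {C R : PlaneForest} {x : ZMod 7} (a : ZMod 7) {M E M' E' : Multiset (ZMod 7)} :
      Labels C a M E → Labels R x M' E' →
        Labels (cons C R) x (a ::ₘ (M + M')) ((x + a) ::ₘ (E + E'))

theorem Labels.cons_of_eq {C R : PlaneForest} {x : ZMod 7} (a : ZMod 7)
    {M E M₁ E₁ M₂ E₂ : Multiset (ZMod 7)} (h₁ : Labels C a M₁ E₁) (h₂ : Labels R x M₂ E₂)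
    (hM : M = a ::ₘ (M₁ + M₂)) (hE : E = (x + a) ::ₘ (E₁ + E₂)) :
    Labels (PlaneForest.cons C R) x M E := by
  subst hM hE; exact .cons a h₁ h₂

theorem labels_cons_iff {C R : PlaneForest} {x : ZMod 7} {M E : Multiset (ZMod 7)} :
    Labels (cons C R) x M E ↔ ∃ a M₁ E₁ M₂ E₂, Labels C a M₁ E₁ ∧ Labels R x M₂ E₂ ∧
      M = a ::ₘ (M₁ + M₂) ∧ E = (x + a) ::ₘ (E₁ + E₂) := by
  constructor
  · rintro (_ | ⟨a, h₁, h₂⟩)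
    exact ⟨a, _, _, _, _, h₁, h₂, rfl, rfl⟩
  · rintro ⟨a, M₁, E₁, M₂, E₂, h₁, h₂, rfl, rfl⟩
    exact .cons a h₁ h₂

theorem labels_nil_iff {x : ZMod 7} {M E : Multiset (ZMod 7)} :
    Labels nil x M E ↔ M = 0 ∧ E = 0 := by
  constructor
  · rintro ⟨⟩; exact ⟨rfl, rfl⟩
  · rintro ⟨rfl, rfl⟩; exact .nil x

theorem size_append (F G : PlaneForest) : (F.append G).size = F.size + G.size := by
  induction F with
  | nil => simp [append, size]
  | cons C R _ ih => simp only [append, size, ih]; omega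

theorem Labels.append {F G : PlaneForest} {x : ZMod 7} {M E M' E' : Multiset (ZMod 7)}
    (hF : Labels F x M E) (hG : Labels G x M' E') :
    Labels (F.append G) x (M + M') (E + E') := by
  induction F generalizing M E with
  | nil =>
    obtain ⟨rfl, rfl⟩ := labels_nil_iff.1 hF
    simpa [PlaneForest.append] using hG
  | cons C R _ ih =>
    obtain ⟨a, M₁, E₁, M₂, E₂, h₁, h₂, rfl, rfl⟩ := labels_cons_iff.1 hF
    exact .cons_of_eq a h₁ (ih h₂) (by simp [add_assoc]) (by simp [add_assoc])

/-- Labels may be transformed by an affine map. -/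
theorem Labels.affine {F : PlaneForest} {x : ZMod 7} {M E : Multiset (ZMod 7)}
    (h : Labels F x M E) (u c : ZMod 7) :
    Labels F (u * x + c) (M.map fun a => u * a + c) (E.map fun a => u * a + 2 * c) := by
  induction h with
  | nil x => exact .nil _
  | cons a _ _ ih₁ ih₂ =>
    refine .cons_of_eq _ ih₁ ih₂ (by simp) ?_
    simp only [Multiset.map_cons, Multiset.map_add]
    congr 1
    ring

theorem map_allResidues {u : ZMod 7} (hu : u ≠ 0) (c : ZMod 7) :
    (allResidues.map fun a => u * a + c) = allResidues := by
  revert u c; decide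

/-! ### A verified search for labelings. -/

/-- The residues of a list of natural numbers. -/
def residues (M : List ℕ) : Multiset (ZMod 7) := (M : Multiset ℕ).map Nat.cast

theorem residues_eq_cons {M : List ℕ} {a : ℕ} (h : a ∈ M) :
    residues M = (a : ZMod 7) ::ₘ residues (M.erase a) := by
  unfold residues
  rw [← Multiset.map_cons, ← Multiset.coe_erase, Multiset.cons_erase (by simpa using h)]

/-- Search for a labeling of `F`, attached to a vertex with label `x`, with labels from `M` and
weights from `E`, such that the unused labels and weights satisfy `k`. -/
def solve : PlaneForest → ℕ → List ℕ → List ℕ → (List ℕ → List ℕ → Bool) → Bool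
  | nil, _, M, E, k => k M E
  | cons C R, x, M, E, k => M.any fun a =>
      E.contains ((x + a) % 7) &&
        solve C a (M.erase a) (E.erase ((x + a) % 7)) fun M E => solve R x M E k

/-- The continuation is arbitrary, so the induction hypothesis for `C` can be used with the
continuation that goes on to label `R` from what is left over. Completeness of the search is never
needed. -/
theorem solve_sound (F : PlaneForest) : ∀ (x : ℕ) (M E : List ℕ) (k : List ℕ → List ℕ → Bool),
    solve F x M E k = true → ∃ M₁ E₁ M₂ E₂, Labels F x M₁ E₁ ∧ k M₂ E₂ = true ∧
      residues M = M₁ + residues M₂ ∧ residues E = E₁ + residues E₂ := by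
  induction F with
  | nil => exact fun x M E k h => ⟨0, 0, M, E, .nil _, h, by simp, by simp⟩
  | cons C R ihC ihR =>
    intro x M E k h
    simp only [solve, List.any_eq_true, Bool.and_eq_true, List.contains_iff_mem] at h
    obtain ⟨a, ha, he, h⟩ := h
    obtain ⟨M₁, E₁, M₂, E₂, h₁, h, hM, hE⟩ := ihC _ _ _ _ h
    obtain ⟨M₃, E₃, M₄, E₄, h₃, h, hM', hE'⟩ := ihR _ _ _ _ h
    refine ⟨_, _, M₄, E₄, .cons (a : ZMod 7) h₁ h₃, h, ?_, ?_⟩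
    · rw [residues_eq_cons ha, hM, hM']; simp [add_assoc]
    · rw [residues_eq_cons he, hE, hE']; simp [add_assoc]

/-- `F` has a labeling that uses `M` and `E` up. -/
def solves (F : PlaneForest) (x : ℕ) (M E : List ℕ) : Bool :=
  solve F x M E fun M E => M.isEmpty && E.isEmpty

theorem labels_of_solves {F : PlaneForest} {x : ℕ} {M E : List ℕ} (h : solves F x M E = true) :
    Labels F x (residues M) (residues E) := by
  obtain ⟨M₁, E₁, M₂, E₂, h₁, h, hM, hE⟩ := solve_sound _ _ _ _ _ h
  simp only [Bool.and_eq_true, List.isEmpty_iff] at h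
  obtain ⟨rfl, rfl⟩ := h
  rw [hM, hE]
  simpa [residues] using h₁

/-! ### Sorted forests and their enumeration. -/

/-- `F` is ordered by decreasing size, at all levels. -/
def sorted : PlaneForest → Bool
  | nil => true
  | cons C R => sorted C && sorted R && match R with
    | nil => true
    | cons D _ => Nat.ble (size D) (size C)

theorem sorted_cons_nil {C : PlaneForest} : sorted (cons C nil) = true ↔ sorted C = true := by
  simp [sorted]

theorem sorted_cons_cons {C D R : PlaneForest} : sorted (cons C (cons D R)) = true ↔
    sorted C = true ∧ sorted (cons D R) = true ∧ size D ≤ size C := by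
  rw [sorted]; simp [and_assoc]

theorem sorted_left {C R : PlaneForest} (h : sorted (cons C R) = true) : sorted C = true := by
  simp only [sorted, Bool.and_eq_true] at h; exact h.1.1

theorem sorted_right {C R : PlaneForest} (h : sorted (cons C R) = true) : sorted R = true := by
  simp only [sorted, Bool.and_eq_true] at h; exact h.1.2

/-- All forests of size `n ≤ f`. -/
def enum : ℕ → ℕ → List PlaneForest
  | _, 0 => [nil]
  | 0, _ + 1 => []
  | f + 1, n + 1 => (List.range (n + 1)).flatMap fun i =>
      (enum f i).flatMap fun C => (enum f (n - i)).map (cons C)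

/-- The first argument of `enum` is fuel for a structural recursion; any amount not less than the
size suffices. -/
theorem mem_enum : ∀ (f : ℕ) (F : PlaneForest), F.size ≤ f → F ∈ enum f F.size
  | f, nil, _ => by cases f <;> simp [enum, size]
  | 0, cons C R, h => by simp [size] at h
  | f + 1, cons C R, h => by
    simp only [size] at h
    have e : (cons C R).size = (C.size + R.size) + 1 := by simp only [size]; omega
    rw [e]
    simp only [enum, List.mem_flatMap, List.mem_range, List.mem_map]
    refine ⟨C.size, by omega, C, mem_enum f C (by omega), R, ?_, rfl⟩
    have := mem_enum f R (by omega)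
    rwa [Nat.add_sub_cancel_left]

/-- All sorted forests of size `n`. -/
def enumSorted (n : ℕ) : List PlaneForest := (enum n n).filter sorted

theorem mem_enumSorted {F : PlaneForest} (h : F.sorted = true) : F ∈ enumSorted F.size :=
  List.mem_filter.2 ⟨mem_enum _ F le_rfl, h⟩

theorem forall_sorted_of_all {p : PlaneForest → Bool} {n : ℕ} (h : (enumSorted n).all p = true)
    {F : PlaneForest} (hF : F.sorted = true) (hn : F.size = n) : p F = true := by
  subst hn; exact List.all_eq_true.1 h F (mem_enumSorted hF)

/-! ### Seven vertices hung from one or two vertices: finite checks. -/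

/-- Attached to one vertex, `F` has a labeling that uses every label and every weight once. -/
def Full (F : PlaneForest) : Prop := ∀ x, Labels F x allResidues allResidues

/-- Attached to two vertices, `F` and `G` have labelings that together use every label and every
weight once. -/
def Full₂ (F G : PlaneForest) : Prop := ∀ x y, ∃ M₁ E₁ M₂ E₂, Labels F x M₁ E₁ ∧
  Labels G y M₂ E₂ ∧ M₁ + M₂ = allResidues ∧ E₁ + E₂ = allResidues

theorem Full₂.symm {F G : PlaneForest} (h : Full₂ F G) : Full₂ G F := fun x y => by
  obtain ⟨M₁, E₁, M₂, E₂, h₁, h₂, hM, hE⟩ := h y x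
  exact ⟨M₂, E₂, M₁, E₁, h₂, h₁, by rw [add_comm, hM], by rw [add_comm, hE]⟩

/-- The numbers less than seven. -/
def digits : List ℕ := [0, 1, 2, 3, 4, 5, 6]

theorem residues_digits : residues digits = allResidues := by decide

/-- A test for `Full`, with the attaching vertex labeled zero. -/
def isFull (F : PlaneForest) : Bool := solves F 0 digits digits

/-- A test for `Full₂`, with the attaching vertices labeled zero, and zero or one. -/
def isFull₂ (F G : PlaneForest) : Bool :=
  [0, 1].all fun y => solve F 0 digits digits fun M E => solves G y M E

theorem full_of_isFull {F : PlaneForest} (h : isFull F = true) : Full F := fun x => by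
  have := (labels_of_solves h).affine 1 x
  rw [residues_digits, map_allResidues (by decide), map_allResidues (by decide)] at this
  simpa using this

/-- Affine maps act on pairs of residues with two orbits, equal and distinct pairs, represented by
(0, 0) and (0, 1). -/
theorem full₂_of_isFull₂ {F G : PlaneForest} (h : isFull₂ F G = true) : Full₂ F G := by
  have key : ∀ n : ℕ, n = 0 ∨ n = 1 → ∀ u c : ZMod 7, u ≠ 0 → ∃ M₁ E₁ M₂ E₂, Labels F c M₁ E₁ ∧
      Labels G (u * n + c) M₂ E₂ ∧ M₁ + M₂ = allResidues ∧ E₁ + E₂ = allResidues := by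
    intro n hn u c hu
    have hs := List.all_eq_true.1 h n (by simpa using hn)
    obtain ⟨M₁, E₁, M₂, E₂, h₁, h, hM, hE⟩ := solve_sound _ _ _ _ _ hs
    have h₁ := h₁.affine u c
    have h₂ := (labels_of_solves h).affine u c
    simp only [Nat.cast_zero, mul_zero, zero_add] at h₁
    refine ⟨_, _, _, _, h₁, h₂, ?_, ?_⟩
    · rw [← Multiset.map_add, ← hM, residues_digits, map_allResidues hu]
    · rw [← Multiset.map_add, ← hE, residues_digits, map_allResidues hu]
  intro x y
  rcases eq_or_ne x y with rfl | hxy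
  · simpa using key 0 (.inl rfl) 1 x (by decide)
  · simpa using key 1 (.inr rfl) (y - x) x (sub_ne_zero.2 hxy.symm)

/-- A root with one child. -/
abbrev path₂ : PlaneForest := cons (leaves 1) nil

/-- The sorted forests of size seven that are not `Full`. -/
def exceptional : List PlaneForest :=
  [cons (leaves 4) path₂, cons (leaves 3) (cons (leaves 1) (leaves 1)),
    cons (leaves 3) (cons (leaves 2) nil), cons (leaves 3) (cons path₂ nil)]

theorem full_of_size_eq_seven {F : PlaneForest} (hF : F.sorted = true) (h : F.size = 7) :
    F ∈ exceptional ∨ Full F := by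
  have : (enumSorted 7).all (fun F => exceptional.contains F || isFull F) = true := by
    decide +kernel
  have := forall_sorted_of_all this hF h
  simp only [Bool.or_eq_true, List.contains_iff_mem] at this
  exact this.imp_right full_of_isFull

theorem full₂_leaf {F : PlaneForest} (hF : F.sorted = true) (h : F.size = 6) (h₁ : F ≠ leaves 6)
    (h₂ : F ≠ cons (leaves 3) path₂) : Full₂ F (leaves 1) := by
  have : (enumSorted 6).all (fun F => [leaves 6, cons (leaves 3) path₂].contains F ||
      isFull₂ F (leaves 1)) = true := by
    decide +kernel
  have := forall_sorted_of_all this hF h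
  simp only [Bool.or_eq_true, List.contains_iff_mem] at this
  exact full₂_of_isFull₂ (this.resolve_left (by simp [h₁, h₂]))

theorem full₂_leaves_two {F : PlaneForest} (hF : F.sorted = true) (h : F.size = 5)
    (h₁ : F ≠ leaves 5) : Full₂ F (leaves 2) := by
  have : (enumSorted 5).all (fun F => [leaves 5].contains F || isFull₂ F (leaves 2)) = true := by
    decide +kernel
  have := forall_sorted_of_all this hF h
  simp only [Bool.or_eq_true, List.contains_iff_mem] at this
  exact full₂_of_isFull₂ (this.resolve_left (by simp [h₁]))

theorem full₂_path₂ {C : PlaneForest} (hC : C.sorted = true) (h : C.size = 4) (h₁ : C ≠ leaves 4) :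
    Full₂ (cons C nil) path₂ := by
  have : (enumSorted 4).all (fun C => [leaves 4].contains C ||
      isFull₂ (cons C nil) path₂) = true := by
    decide +kernel
  have := forall_sorted_of_all this hC h
  simp only [Bool.or_eq_true, List.contains_iff_mem] at this
  exact full₂_of_isFull₂ (this.resolve_left (by simp [h₁]))

theorem full₂_leaves_three {F : PlaneForest} (hF : F.sorted = true) (h : F.size = 4)
    (h₁ : F ≠ leaves 4) : Full₂ F (leaves 3) := by
  have : (enumSorted 4).all (fun F => [leaves 4].contains F || isFull₂ F (leaves 3)) = true := by
    decide +kernel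
  have := forall_sorted_of_all this hF h
  simp only [Bool.or_eq_true, List.contains_iff_mem] at this
  exact full₂_of_isFull₂ (this.resolve_left (by simp [h₁]))

theorem full₂_leaves_four {C : PlaneForest} (hC : C.sorted = true) (h : C.size = 2) :
    Full₂ (cons C nil) (leaves 4) := by
  have : (enumSorted 2).all (fun C => isFull₂ (cons C nil) (leaves 4)) = true := by
    decide +kernel
  exact full₂_of_isFull₂ (forall_sorted_of_all this hC h)

theorem full₂_three {C D : PlaneForest} (hC : C.sorted = true) (h : C.size = 3)
    (hD : D.sorted = true) (h' : D.size = 3) (h₁ : C ≠ leaves 3) : Full₂ (cons C nil) D := by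
  have : (enumSorted 3).all (fun C => [leaves 3].contains C || (enumSorted 3).all fun D =>
      isFull₂ (cons C nil) D) = true := by
    decide +kernel
  have := forall_sorted_of_all this hC h
  simp only [Bool.or_eq_true, List.contains_iff_mem] at this
  exact full₂_of_isFull₂ (forall_sorted_of_all (this.resolve_left (by simp [h₁])) hD h')

/-- For small forests there is a labeling without repeated labels or weights. -/
theorem exists_labels_of_size_le_six {F : PlaneForest} (hF : F.sorted = true) (h : F.size ≤ 6) :
    ∃ M E, Labels F 0 M E ∧ 0 ::ₘ M ≤ allResidues ∧ E ≤ allResidues := by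
  -- The label 0 is withheld because the root already has it; the continuation accepts any leftover
  -- labels and weights.
  have : (List.range 7).all (fun n => (enumSorted n).all fun F =>
      solve F 0 [1, 2, 3, 4, 5, 6] digits fun _ _ => true) = true := by
    decide +kernel
  have := List.all_eq_true.1 this F.size (by simp; omega)
  obtain ⟨M₁, E₁, M₂, E₂, h₁, -, hM, hE⟩ := solve_sound _ _ _ _ _ (forall_sorted_of_all this hF rfl)
  refine ⟨M₁, E₁, by simpa using h₁, ?_, ?_⟩
  · have e : allResidues = 0 ::ₘ residues [1, 2, 3, 4, 5, 6] := by decide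
    rw [e, hM]
    exact Multiset.cons_le_cons _ (Multiset.le_add_right _ _)
  · rw [← residues_digits, hE]
    exact Multiset.le_add_right _ _

/-! ### Sorting a forest without losing labelings. -/

/-- Every labeling of `G` gives one of `F`. -/
structure Relabels (G F : PlaneForest) : Prop where
  size_eq : G.size = F.size
  labels : ∀ {x M E}, Labels G x M E → Labels F x M E

theorem Relabels.refl (F : PlaneForest) : Relabels F F := ⟨rfl, id⟩

theorem Relabels.trans {F G H : PlaneForest} (h₁ : Relabels F G) (h₂ : Relabels G H) :
    Relabels F H := ⟨h₁.1.trans h₂.1, fun h => h₂.2 (h₁.2 h)⟩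

theorem Relabels.cons {C C' R R' : PlaneForest} (h₁ : Relabels C C') (h₂ : Relabels R R') :
    Relabels (cons C R) (cons C' R') := by
  refine ⟨by simp only [size, h₁.1, h₂.1], fun h => ?_⟩
  obtain ⟨a, M₁, E₁, M₂, E₂, h₃, h₄, rfl, rfl⟩ := labels_cons_iff.1 h
  exact .cons a (h₁.2 h₃) (h₂.2 h₄)

theorem Relabels.swap (C D R : PlaneForest) :
    Relabels (PlaneForest.cons C (PlaneForest.cons D R))
      (PlaneForest.cons D (PlaneForest.cons C R)) := by
  refine ⟨by simp only [size]; omega, fun h => ?_⟩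
  obtain ⟨a, M₁, E₁, M₂, E₂, h₁, h₂, rfl, rfl⟩ := labels_cons_iff.1 h
  obtain ⟨b, M₃, E₃, M₄, E₄, h₃, h₄, rfl, rfl⟩ := labels_cons_iff.1 h₂
  refine .cons_of_eq b h₃ (.cons a h₁ h₄) ?_ ?_ <;>
    · simp only [← Multiset.singleton_add]; abel

/-- Insertion of a tree into a list of trees sorted by decreasing size. -/
def insertTree (C : PlaneForest) : PlaneForest → PlaneForest
  | nil => cons C nil
  | cons D R => if size D ≤ size C then cons C (cons D R) else cons D (insertTree C R)

theorem relabels_insertTree (C R : PlaneForest) : Relabels (insertTree C R) (cons C R) := by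
  induction R with
  | nil => exact .refl _
  | cons D R _ ih =>
    rw [insertTree]
    split_ifs
    · exact .refl _
    · exact (Relabels.cons (.refl D) ih).trans (.swap D C R)

theorem sorted_insertTree {C R : PlaneForest} (hC : C.sorted = true) (hR : R.sorted = true) :
    (insertTree C R).sorted = true := by
  induction R with
  | nil => exact sorted_cons_nil.2 hC
  | cons D R _ ih =>
    rw [insertTree]
    split_ifs with h
    · exact sorted_cons_cons.2 ⟨hC, hR, h⟩
    · have ih := ih (sorted_right hR)
      cases R with
      | nil => exact sorted_cons_cons.2 ⟨sorted_left hR, ih, by omega⟩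
      | cons D' R =>
        rw [sorted_cons_cons] at hR
        rw [insertTree] at ih ⊢
        split_ifs at ih ⊢
        · exact sorted_cons_cons.2 ⟨hR.1, ih, by omega⟩
        · exact sorted_cons_cons.2 ⟨hR.1, ih, hR.2.2⟩

theorem exists_sorted (F : PlaneForest) : ∃ G, G.sorted = true ∧ Relabels G F := by
  induction F with
  | nil => exact ⟨nil, rfl, .refl _⟩
  | cons C R ihC ihR =>
    obtain ⟨C', hC, hC'⟩ := ihC
    obtain ⟨R', hR, hR'⟩ := ihR
    exact ⟨_, sorted_insertTree hC hR, (relabels_insertTree C' R').trans (hC'.cons hR')⟩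

/-! ### Reductions and detachable pieces. -/

/-- Every labeling of some smaller forest gives a labeling of `F` in which all labels, and all
weights, occur `n` more times. -/
def Reducible (F : PlaneForest) : Prop := ∃ F' : PlaneForest, ∃ n : ℕ, F'.size < F.size ∧
  ∀ x M E, Labels F' x M E → Labels F x (M + n • allResidues) (E + n • allResidues)

theorem Reducible.of_relabels {F G : PlaneForest} (h : Reducible G) (hGF : Relabels G F) :
    Reducible F := by
  obtain ⟨F', n, hs, h⟩ := h
  exact ⟨F', n, hGF.1 ▸ hs, fun x M E hF => hGF.2 (h x M E hF)⟩

/-- A reduction is valid for every attaching label, so it can be carried out below any vertex. -/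
theorem Reducible.left {C : PlaneForest} (h : Reducible C) (R : PlaneForest) :
    Reducible (cons C R) := by
  obtain ⟨C', n, hs, h⟩ := h
  refine ⟨cons C' R, n, by simp only [size]; omega, fun x M E hF => ?_⟩
  obtain ⟨a, M₁, E₁, M₂, E₂, h₁, h₂, rfl, rfl⟩ := labels_cons_iff.1 hF
  refine .cons_of_eq a (h _ _ _ h₁) h₂ ?_ ?_ <;>
    · simp only [← Multiset.singleton_add]; abel

theorem Reducible.right {R : PlaneForest} (h : Reducible R) (C : PlaneForest) :
    Reducible (cons C R) := by
  obtain ⟨R', n, hs, h⟩ := h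
  refine ⟨cons C R', n, by simp only [size]; omega, fun x M E hF => ?_⟩
  obtain ⟨a, M₁, E₁, M₂, E₂, h₁, h₂, rfl, rfl⟩ := labels_cons_iff.1 hF
  refine .cons_of_eq a h₁ (h _ _ _ h₂) ?_ ?_ <;>
    · simp only [← Multiset.singleton_add]; abel

theorem Reducible.of_full {A : PlaneForest} (h : Full A) (hA : 0 < A.size) (R : PlaneForest) :
    Reducible (A.append R) := by
  refine ⟨R, 1, by rw [size_append]; omega, fun x M E hR => ?_⟩
  have := (h x).append hR
  rwa [one_nsmul, add_comm M, add_comm E]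

/-- `C` is `C'` with `G` attached to one of the vertices of `C'`, or beside `C'`. -/
structure Attaches (G C' C : PlaneForest) : Prop where
  size_le : C'.size ≤ C.size
  labels : ∀ {x M E}, Labels C' x M E → ∃ y, ∀ {M' E'}, Labels G y M' E' →
    Labels C x (M + M') (E + E')

theorem Attaches.append (G R : PlaneForest) : Attaches G R (G.append R) := by
  refine ⟨by rw [size_append]; omega, fun {x M E} h => ⟨x, fun {M' E'} h' => ?_⟩⟩
  rw [add_comm M, add_comm E]
  exact h'.append h

theorem Attaches.self (G : PlaneForest) : Attaches G nil G := by
  refine ⟨by simp only [size]; omega, fun {x M E} h => ⟨x, fun {M' E'} h' => ?_⟩⟩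
  obtain ⟨rfl, rfl⟩ := labels_nil_iff.1 h
  simpa using h'

theorem Attaches.left {G C' C : PlaneForest} (h : Attaches G C' C) (R : PlaneForest) :
    Attaches G (cons C' R) (cons C R) := by
  refine ⟨by have := h.1; simp only [size]; omega, fun {x M E} hF => ?_⟩
  obtain ⟨a, M₁, E₁, M₂, E₂, h₁, h₂, rfl, rfl⟩ := labels_cons_iff.1 hF
  obtain ⟨y, hy⟩ := h.2 h₁
  refine ⟨y, fun {M' E'} h' => .cons_of_eq a (hy h') h₂ ?_ ?_⟩ <;>
    · simp only [← Multiset.singleton_add]; abel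

theorem Attaches.right {G R' R : PlaneForest} (h : Attaches G R' R) (C : PlaneForest) :
    Attaches G (cons C R') (cons C R) := by
  refine ⟨by have := h.1; simp only [size]; omega, fun {x M E} hF => ?_⟩
  obtain ⟨a, M₁, E₁, M₂, E₂, h₁, h₂, rfl, rfl⟩ := labels_cons_iff.1 hF
  obtain ⟨y, hy⟩ := h.2 h₂
  refine ⟨y, fun {M' E'} h' => .cons_of_eq a h₁ (hy h') ?_ ?_⟩ <;>
    · simp only [← Multiset.singleton_add]; abel

theorem exists_attaches_leaf {C : PlaneForest} (h : 0 < C.size) :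
    ∃ C', Attaches (leaves 1) C' C := by
  induction C with
  | nil => simp [size] at h
  | cons C R ih _ =>
    cases C with
    | nil => exact ⟨R, .append (leaves 1) R⟩
    | cons D S =>
      obtain ⟨C', h⟩ := ih (by simp only [size]; omega)
      exact ⟨_, h.left R⟩

theorem eq_nil_of_size_eq_zero {F : PlaneForest} (h : F.size = 0) : F = nil := by
  cases F with
  | nil => rfl
  | cons C R => simp only [size] at h; omega

theorem eq_leaves_one {F : PlaneForest} (h : F.size = 1) : F = leaves 1 := by
  cases F with
  | nil => simp [size] at h
  | cons C R =>
    simp only [size] at h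
    rw [eq_nil_of_size_eq_zero (F := C) (by omega), eq_nil_of_size_eq_zero (F := R) (by omega)]
    rfl

/-- Descend while a part still has two vertices. Where both parts have at most one, the piece is two
sibling leaves or a root with one child. -/
theorem exists_attaches_two {C : PlaneForest} (h : 2 ≤ C.size) :
    ∃ C', Attaches (leaves 2) C' C ∨ Attaches path₂ C' C := by
  induction C with
  | nil => simp [size] at h
  | cons C R ihC ihR =>
    simp only [size] at h
    rcases le_or_gt 2 C.size with hC | hC
    · obtain ⟨C', h | h⟩ := ihC hC
      exacts [⟨_, .inl (h.left R)⟩, ⟨_, .inr (h.left R)⟩]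
    rcases le_or_gt 2 R.size with hR | hR
    · obtain ⟨R', h | h⟩ := ihR hR
      exacts [⟨_, .inl (h.right C)⟩, ⟨_, .inr (h.right C)⟩]
    rcases Nat.eq_zero_or_pos C.size with hC₀ | hC₀
    · rw [eq_nil_of_size_eq_zero hC₀, eq_leaves_one (F := R) (by omega)]
      exact ⟨_, .inl (.self (leaves 2))⟩
    · rw [eq_leaves_one (F := C) (by omega)]
      exact ⟨R, .inr (.append path₂ R)⟩

/-- Remove `A` and also `G` from inside the next tree. A labeling of the rest fixes the two
attaching labels, and `Full₂` covers every such pair. -/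
theorem Reducible.of_full₂ {A G C' C : PlaneForest} (h : Full₂ A G) (hA : 0 < A.size)
    (hC : Attaches G C' C) (R : PlaneForest) : Reducible (A.append (cons C R)) := by
  refine ⟨cons C' R, 1, ?_, fun x M E hR => ?_⟩
  · have := hC.1; rw [size_append]; simp only [size]; omega
  obtain ⟨a, M₁, E₁, M₂, E₂, h₁, h₂, rfl, rfl⟩ := labels_cons_iff.1 hR
  obtain ⟨y, hy⟩ := hC.2 h₁
  obtain ⟨M₃, E₃, M₄, E₄, h₃, h₄, hM, hE⟩ := h x y
  have := h₃.append (.cons a (hy h₄) h₂)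
  convert this using 1
  · rw [← hM]; simp only [← Multiset.singleton_add]; abel
  · rw [← hE]; simp only [← Multiset.singleton_add]; abel

/-! ### Case analysis when all trees are small. -/

/-- The sizes of the forests below the roots. -/
def rootSizes : PlaneForest → List ℕ
  | nil => []
  | cons C R => size C :: rootSizes R

/-- Lets most forests be recognized as not exceptional from sizes alone. -/
theorem rootSizes_of_mem_exceptional : ∀ F ∈ exceptional,
    rootSizes F = [4, 1] ∨ rootSizes F = [3, 1, 0] ∨ rootSizes F = [3, 2] := by decide

theorem reducible_of_prefix {A : PlaneForest} (hA : A.sorted = true) (h : A.size = 7)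
    (h₁ : A ∉ exceptional) (R : PlaneForest) : Reducible (A.append R) :=
  .of_full ((full_of_size_eq_seven hA h).resolve_left h₁) (by omega) R

theorem size_leaves (n : ℕ) : (leaves n).size = n := by
  induction n with
  | zero => rfl
  | succ n ih => simp only [leaves, size, ih]; omega

theorem rootSizes_leaves (n : ℕ) : (leaves n).rootSizes = List.replicate n 0 := by
  induction n with
  | zero => rfl
  | succ n ih => simp only [leaves, rootSizes, ih, size, List.replicate_succ]

theorem sorted_cons_leaves {C : PlaneForest} (hC : C.sorted = true) (n : ℕ) :
    sorted (cons C (leaves n)) = true := by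
  induction n generalizing C with
  | zero => exact sorted_cons_nil.2 hC
  | succ n ih => exact sorted_cons_cons.2 ⟨hC, ih rfl, Nat.zero_le _⟩

/-- Once a sorted forest reaches a one-vertex tree, all later trees are single vertices too, and any
number of them can be split off. -/
theorem exists_eq_leaves_append {R : PlaneForest} (hR : sorted (cons nil R) = true) :
    ∀ {n : ℕ}, n ≤ (cons nil R).size → ∃ R', cons nil R = (leaves n).append R' := by
  induction R with
  | nil =>
    intro n hn
    simp only [size] at hn
    obtain rfl | rfl : n = 0 ∨ n = 1 := by omega
    exacts [⟨_, rfl⟩, ⟨nil, rfl⟩]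
  | cons D R _ ih =>
    intro n hn
    rw [sorted_cons_cons] at hR
    obtain rfl : D = nil := eq_nil_of_size_eq_zero (by simpa [size] using hR.2.2)
    cases n with
    | zero => exact ⟨_, rfl⟩
    | succ n =>
      obtain ⟨R', h⟩ := ih hR.2.1 (n := n) (by simp only [size] at hn ⊢; omega)
      exact ⟨R', by rw [h]; rfl⟩

theorem cons_ne_leaves {C R : PlaneForest} (h : 0 < C.size) (n : ℕ) : cons C R ≠ leaves n := by
  rintro e
  cases n with
  | zero => cases e
  | succ n => cases e; simp [size] at h

theorem relabels_append_cons (A C R : PlaneForest) :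
    Relabels (A.append (cons C R)) (cons C (A.append R)) := by
  induction A with
  | nil => exact .refl _
  | cons D A _ ih => exact (Relabels.cons (.refl D) ih).trans (.swap D C _)

/-- Here the first tree lends `G` to the trees after it; this serves when the first tree is a star
with leaves to spare. -/
theorem Reducible.of_full₂_left {A G C' C : PlaneForest} (h : Full₂ A G) (hA : 0 < A.size)
    (hC : Attaches G C' C) (R : PlaneForest) : Reducible (cons C (A.append R)) :=
  (Reducible.of_full₂ h hA hC R).of_relabels (relabels_append_cons A C R)

theorem sorted_pair {C D : PlaneForest} (hC : C.sorted = true) (hD : D.sorted = true)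
    (h : D.size ≤ C.size) : sorted (cons C (cons D nil)) = true :=
  sorted_cons_cons.2 ⟨hC, sorted_cons_nil.2 hD, h⟩

theorem sorted_triple {C D B : PlaneForest} (hC : C.sorted = true) (hD : D.sorted = true)
    (hB : B.sorted = true) (h : D.size ≤ C.size) (h' : B.size ≤ D.size) :
    sorted (cons C (cons D (cons B nil))) = true :=
  sorted_cons_cons.2 ⟨hC, sorted_pair hD hB h', h⟩

theorem not_mem_exceptional_of_rootSizes {F : PlaneForest} (h₁ : rootSizes F ≠ [4, 1])
    (h₂ : rootSizes F ≠ [3, 1, 0]) (h₃ : rootSizes F ≠ [3, 2]) : F ∉ exceptional := fun h => by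
  have := rootSizes_of_mem_exceptional F h
  tauto

/-- An exceptional forest begins with a star, whose leaves can be lent to later trees. -/
theorem eq_leaves_of_mem_exceptional {C D R : PlaneForest} (h : cons C (cons D R) ∈ exceptional) :
    C = leaves C.size := by
  simp only [exceptional, List.mem_cons, cons.injEq, List.not_mem_nil, or_false] at h
  obtain ⟨rfl, -⟩ | ⟨rfl, -⟩ | ⟨rfl, -⟩ | ⟨rfl, -⟩ := h <;> rfl

/-- Reduction when the largest tree has six vertices. -/
theorem reducible_of_size_eq_five {C D R : PlaneForest} (hC : C.sorted = true)
    (h : C.size = 5) : Reducible (cons C (cons D R)) := by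
  rcases Nat.eq_zero_or_pos D.size with hD | hD
  · obtain rfl := eq_nil_of_size_eq_zero hD
    exact reducible_of_prefix (A := cons C (leaves 1)) (sorted_cons_leaves hC 1)
      (by simp [size, size_leaves, h])
      (not_mem_exceptional_of_rootSizes (by simp [rootSizes, h]) (by simp [rootSizes, h])
        (by simp [rootSizes, h])) R
  -- The six vertices of the first tree borrow a leaf from the second.
  · obtain ⟨D', hD'⟩ := exists_attaches_leaf hD
    refine .of_full₂ (A := cons C nil) (full₂_leaf (sorted_cons_nil.2 hC) (by simp [size, h])
      (cons_ne_leaves (by omega) _) (by simp)) (by simp [size]) hD' R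

/-- Reduction when the largest tree has five vertices. -/
theorem reducible_of_size_eq_four {C D R : PlaneForest} (hs : sorted (cons C (cons D R)) = true)
    (h : C.size = 4) (h8 : 8 ≤ (cons C (cons D R)).size) : Reducible (cons C (cons D R)) := by
  obtain ⟨hC, hs, hDC⟩ := sorted_cons_cons.1 hs
  have hD := sorted_left hs
  rcases le_or_gt 2 D.size with h2 | h2
  · by_cases hl : C = leaves 4
    · subst hl
      -- The star lends exactly as many leaves as the second tree needs to reach seven vertices.
      obtain h2 | h2 | h2 : D.size = 2 ∨ D.size = 3 ∨ D.size = 4 := by omega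
      · exact .of_full₂_left (A := cons D nil) (full₂_leaves_four hD h2) (by simp [size])
          (.self _) R
      · exact .of_full₂_left (A := cons D nil) (full₂_leaves_three (sorted_cons_nil.2 hD)
          (by simp [size, h2]) (cons_ne_leaves (by omega) _)) (by simp [size])
          (.append (leaves 3) (leaves 1)) R
      · exact .of_full₂_left (A := cons D nil) (full₂_leaves_two (sorted_cons_nil.2 hD)
          (by simp [size, h2]) (cons_ne_leaves (by omega) _)) (by simp [size])
          (.append (leaves 2) (leaves 2)) R
    · obtain ⟨D', hD' | hD'⟩ := exists_attaches_two h2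
      · exact .of_full₂ (A := cons C nil) (full₂_leaves_two (sorted_cons_nil.2 hC)
          (by simp [size, h]) (cons_ne_leaves (by omega) _)) (by simp [size]) hD' R
      · exact .of_full₂ (A := cons C nil) (full₂_path₂ hC h hl) (by simp [size]) hD' R
  obtain h1 | h0 : D.size = 1 ∨ D.size = 0 := by omega
  · by_cases he : cons C (cons D nil) ∈ exceptional
    · cases R with
      | nil => simp [size, h, h1] at h8
      | cons B R =>
        obtain ⟨-, hB, hBD⟩ := sorted_cons_cons.1 hs
        have hB := sorted_left hB
        obtain h1' | h0' : B.size = 1 ∨ B.size = 0 := by omega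
        · rw [eq_leaves_of_mem_exceptional he, h]
          exact .of_full₂_left (A := cons D (cons B nil)) (full₂_leaves_three
            (sorted_pair hD hB hBD) (by simp [size, h1, h1']) (cons_ne_leaves (by omega) _))
            (by simp [size]) (.append (leaves 3) (leaves 1)) R
        · obtain rfl := eq_nil_of_size_eq_zero h0'
          -- Regroup: the first tree and the single vertex make six, and the skipped second tree
          -- supplies the seventh.
          obtain ⟨D', hD'⟩ := exists_attaches_leaf (C := D) (by omega)
          exact (Reducible.of_full₂ (A := cons C (leaves 1)) (full₂_leaf (sorted_cons_leaves hC 1)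
            (by simp [size, size_leaves, h]) (cons_ne_leaves (by omega) _)
            (by rintro ⟨⟩)) (by simp [size]) hD' R).of_relabels
              (.cons (.refl C) (.swap _ _ _))
    · exact reducible_of_prefix (A := cons C (cons D nil)) (sorted_pair hC hD hDC)
        (by simp [size, h, h1]) he R
  · obtain rfl := eq_nil_of_size_eq_zero h0
    obtain ⟨R', hR'⟩ := exists_eq_leaves_append hs (n := 2) (by
      simp only [size] at h8 ⊢; omega)
    rw [hR']
    exact reducible_of_prefix (A := cons C (leaves 2)) (sorted_cons_leaves hC 2)
      (by simp [size, size_leaves, h])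
      (not_mem_exceptional_of_rootSizes (by simp [rootSizes, h, rootSizes_leaves])
        (by simp [rootSizes, h]) (by simp [rootSizes, h, rootSizes_leaves])) R'

/-- Reduction when the largest tree has four vertices. -/
theorem reducible_of_size_eq_three {C D R : PlaneForest} (hs : sorted (cons C (cons D R)) = true)
    (h : C.size = 3) (h8 : 8 ≤ (cons C (cons D R)).size) : Reducible (cons C (cons D R)) := by
  obtain ⟨hC, hs, hDC⟩ := sorted_cons_cons.1 hs
  have hD := sorted_left hs
  obtain h3 | h2 | h1 | h0 : D.size = 3 ∨ D.size = 2 ∨ D.size = 1 ∨ D.size = 0 := by omega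
  · by_cases hl : C = leaves 3
    · subst hl
      exact .of_full₂_left (A := cons D nil) (full₂_leaves_three (sorted_cons_nil.2 hD)
          (by simp [size, h3]) (cons_ne_leaves (by omega) _)) (by simp [size]) (.self _) R
    · exact .of_full₂ (A := cons C nil) (full₂_three hC h hD h3 hl) (by simp [size]) (.self _) R
  · by_cases he : cons C (cons D nil) ∈ exceptional
    · rw [eq_leaves_of_mem_exceptional he, h]
      cases R with
      | nil => simp [size, h, h2] at h8
      | cons B R =>
        obtain ⟨-, hB, hBD⟩ := sorted_cons_cons.1 hs
        have hDB := sorted_pair hD (sorted_left hB) hBD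
        have hl := cons_ne_leaves (C := D) (R := cons B nil) (by omega)
        -- The second and third trees have six, five or four vertices; the star lends one, two or
        -- three leaves.
        obtain h2' | h1' | h0' : B.size = 2 ∨ B.size = 1 ∨ B.size = 0 := by omega
        · refine .of_full₂_left (A := cons D (cons B nil)) (full₂_leaf hDB
            (by simp [size, h2, h2']) (hl _) ?_) (by simp [size])
            (.append (leaves 1) (leaves 2)) R
          rintro ⟨⟩
          simp [size_leaves] at h2
        · exact .of_full₂_left (A := cons D (cons B nil)) (full₂_leaves_two hDB
            (by simp [size, h2, h1']) (hl _)) (by simp [size])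
            (.append (leaves 2) (leaves 1)) R
        · exact .of_full₂_left (A := cons D (cons B nil)) (full₂_leaves_three hDB
            (by simp [size, h2, h0']) (hl _)) (by simp [size]) (.self _) R
    · exact reducible_of_prefix (A := cons C (cons D nil)) (sorted_pair hC hD hDC)
        (by simp [size, h, h2]) he R
  · cases R with
    | nil => simp [size, h, h1] at h8
    | cons B R =>
      obtain ⟨-, hs', hBD⟩ := sorted_cons_cons.1 hs
      have hB := sorted_left hs'
      obtain ⟨D', hD'⟩ := exists_attaches_leaf (C := D) (by omega)
      obtain h1' | h0' : B.size = 1 ∨ B.size = 0 := by omega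
      -- The split is forced by `full₂_leaf`, which excludes a three-leaf star beside a two-vertex
      -- tree. In that case the star lends its leaves instead.
      · by_cases hl : C = leaves 3
        · subst hl
          exact .of_full₂_left (A := cons D (cons B nil)) (full₂_leaves_three
            (sorted_pair hD hB hBD) (by simp [size, h1, h1']) (cons_ne_leaves (by omega) _))
            (by simp [size]) (.self _) R
        · obtain ⟨B', hB'⟩ := exists_attaches_leaf (C := B) (by omega)
          refine .of_full₂ (A := cons C (cons D nil)) (full₂_leaf (sorted_pair hC hD hDC)
            (by simp [size, h, h1]) (cons_ne_leaves (by omega) _) ?_) (by simp [size]) hB' R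
          rintro ⟨⟩
          exact hl rfl
      · obtain rfl := eq_nil_of_size_eq_zero h0'
        obtain ⟨R', hR'⟩ := exists_eq_leaves_append hs' (n := 2) (by
          simp only [size] at h8 ⊢; omega)
        rw [hR']
        refine (Reducible.of_full₂_left (A := cons C (leaves 2)) (full₂_leaf
          (sorted_cons_leaves hC 2) (by simp [size, size_leaves, h]) (cons_ne_leaves (by omega) _)
          (by rintro ⟨⟩)) (by simp [size]) hD' R').of_relabels (.swap _ _ _)
  · obtain rfl := eq_nil_of_size_eq_zero h0
    obtain ⟨R', hR'⟩ := exists_eq_leaves_append hs (n := 3) (by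
      simp only [size] at h8 ⊢; omega)
    rw [hR']
    exact reducible_of_prefix (A := cons C (leaves 3)) (sorted_cons_leaves hC 3)
      (by simp [size, size_leaves, h])
      (not_mem_exceptional_of_rootSizes (by simp [rootSizes, h])
        (by simp [rootSizes, h, leaves, size]) (by simp [rootSizes, h, rootSizes_leaves])) R'

/-- Reduction when the largest tree has three vertices. -/
theorem reducible_of_size_eq_two {C D R : PlaneForest} (hs : sorted (cons C (cons D R)) = true)
    (h : C.size = 2) (h8 : 8 ≤ (cons C (cons D R)).size) : Reducible (cons C (cons D R)) := by
  obtain ⟨hC, hs, hDC⟩ := sorted_cons_cons.1 hs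
  have hD := sorted_left hs
  have ne : ∀ {R}, cons C R ∉ exceptional := fun {R} => not_mem_exceptional_of_rootSizes
    (by simp [rootSizes, h]) (by simp [rootSizes, h]) (by simp [rootSizes, h])
  rcases Nat.eq_zero_or_pos D.size with h0 | hD₀
  · obtain rfl := eq_nil_of_size_eq_zero h0
    obtain ⟨R', hR'⟩ := exists_eq_leaves_append hs (n := 4) (by
      simp only [size] at h8 ⊢; omega)
    rw [hR']
    exact reducible_of_prefix (A := cons C (leaves 4)) (sorted_cons_leaves hC 4)
      (by simp [size, size_leaves, h]) ne R'
  cases R with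
  | nil => simp only [size] at h8; omega
  | cons B R =>
    obtain ⟨-, hs', hBD⟩ := sorted_cons_cons.1 hs
    have hB := sorted_left hs'
    obtain h2 | h1 : D.size = 2 ∨ D.size = 1 := by omega
    · rcases Nat.eq_zero_or_pos B.size with h0 | hB₀
      · exact reducible_of_prefix (A := cons C (cons D (cons B nil)))
          (sorted_triple hC hD hB hDC hBD) (by simp [size, h, h2, h0]) ne R
      · obtain ⟨B', hB'⟩ := exists_attaches_leaf hB₀
        refine .of_full₂ (A := cons C (cons D nil)) (full₂_leaf (sorted_pair hC hD hDC)
            (by simp [size, h, h2]) (cons_ne_leaves (by omega) _) ?_) (by simp [size]) hB' R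
        rintro ⟨⟩
        simp [size_leaves] at h
    · obtain h1' | h0 : B.size = 1 ∨ B.size = 0 := by omega
      · exact reducible_of_prefix (A := cons C (cons D (cons B nil)))
          (sorted_triple hC hD hB hDC hBD) (by simp [size, h, h1, h1']) ne R
      · obtain rfl := eq_nil_of_size_eq_zero h0
        obtain ⟨R', hR'⟩ := exists_eq_leaves_append hs' (n := 2) (by
          simp only [size] at h8 ⊢; omega)
        rw [hR']
        exact reducible_of_prefix (A := cons C (cons D (leaves 2)))
          (sorted_cons_cons.2 ⟨hC, sorted_cons_leaves hD 2, hDC⟩)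
          (by simp [size, size_leaves, h, h1]) ne R'

/-- Reduction when the largest tree has two vertices. -/
theorem reducible_of_size_eq_one {C D R : PlaneForest} (hs : sorted (cons C (cons D R)) = true)
    (h : C.size = 1) (h8 : 8 ≤ (cons C (cons D R)).size) : Reducible (cons C (cons D R)) := by
  obtain ⟨hC, hs, hDC⟩ := sorted_cons_cons.1 hs
  have hD := sorted_left hs
  have ne : ∀ {R}, cons C R ∉ exceptional := fun {R} => not_mem_exceptional_of_rootSizes
    (by simp [rootSizes, h]) (by simp [rootSizes, h]) (by simp [rootSizes, h])
  obtain h1 | h0 : D.size = 1 ∨ D.size = 0 := by omega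
  swap
  · obtain rfl := eq_nil_of_size_eq_zero h0
    obtain ⟨R', hR'⟩ := exists_eq_leaves_append hs (n := 5) (by
      simp only [size] at h8 ⊢; omega)
    rw [hR']
    exact reducible_of_prefix (A := cons C (leaves 5)) (sorted_cons_leaves hC 5)
      (by simp [size, size_leaves, h]) ne R'
  cases R with
  | nil => simp [size, h, h1] at h8
  | cons B R =>
    obtain ⟨-, hs', hBD⟩ := sorted_cons_cons.1 hs
    have hB := sorted_left hs'
    obtain h1' | h0 : B.size = 1 ∨ B.size = 0 := by omega
    swap
    · obtain rfl := eq_nil_of_size_eq_zero h0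
      obtain ⟨R', hR'⟩ := exists_eq_leaves_append hs' (n := 3) (by
        simp only [size] at h8 ⊢; omega)
      rw [hR']
      exact reducible_of_prefix (A := cons C (cons D (leaves 3)))
        (sorted_cons_cons.2 ⟨hC, sorted_cons_leaves hD 3, hDC⟩)
        (by simp [size, size_leaves, h, h1]) ne R'
    cases R with
    | nil => simp [size, h, h1, h1'] at h8
    | cons S R =>
      obtain ⟨-, hs'', hSB⟩ := sorted_cons_cons.1 hs'
      obtain h1'' | h0 : S.size = 1 ∨ S.size = 0 := by omega
      · obtain ⟨S', hS'⟩ := exists_attaches_leaf (C := S) (by omega)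
        refine .of_full₂ (A := cons C (cons D (cons B nil))) (full₂_leaf
          (sorted_triple hC hD hB hDC hBD) (by simp [size, h, h1, h1'])
          (cons_ne_leaves (by omega) _) ?_) (by simp [size]) hS' R
        rintro ⟨⟩
      · obtain rfl := eq_nil_of_size_eq_zero h0
        exact reducible_of_prefix (A := cons C (cons D (cons B (leaves 1))))
          (sorted_cons_cons.2 ⟨hC, sorted_cons_cons.2 ⟨hD, sorted_cons_leaves hB 1, hBD⟩, hDC⟩)
          (by simp [size, size_leaves, h, h1, h1']) ne R

theorem reducible_of_size_le_five {C R : PlaneForest} (hs : sorted (cons C R) = true)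
    (h : C.size ≤ 5) (h8 : 8 ≤ (cons C R).size) : Reducible (cons C R) := by
  cases R with
  | nil => simp only [size] at h8; omega
  | cons D R =>
    obtain h | h | h | h | h | h : C.size = 5 ∨ C.size = 4 ∨ C.size = 3 ∨ C.size = 2 ∨
      C.size = 1 ∨ C.size = 0 := by omega
    · exact reducible_of_size_eq_five (sorted_left hs) h
    · exact reducible_of_size_eq_four hs h h8
    · exact reducible_of_size_eq_three hs h h8
    · exact reducible_of_size_eq_two hs h h8
    · exact reducible_of_size_eq_one hs h h8
    · obtain rfl := eq_nil_of_size_eq_zero h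
      obtain ⟨R', hR'⟩ := exists_eq_leaves_append hs (n := 7) (by omega)
      rw [hR']
      exact reducible_of_prefix (A := leaves 7) rfl rfl (by decide) R'

/-! ### Exceptional forests under a new root, and the double star. -/

theorem residues_cons (a : ℕ) (M : List ℕ) : residues (a :: M) = (a : ZMod 7) ::ₘ residues M := rfl

theorem Labels.append_of_eq {F G : PlaneForest} {x : ZMod 7}
    {M E M₁ E₁ M₂ E₂ : Multiset (ZMod 7)} (hF : Labels F x M₁ E₁) (hG : Labels G x M₂ E₂)
    (hM : M = M₁ + M₂) (hE : E = E₁ + E₂) : Labels (F.append G) x M E := by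
  subst hM hE; exact hF.append hG

theorem labels_nil_cons_iff {R : PlaneForest} {x : ZMod 7} {M E : Multiset (ZMod 7)} :
    Labels (cons nil R) x M E ↔ ∃ a M' E', Labels R x M' E' ∧ M = a ::ₘ M' ∧
      E = (x + a) ::ₘ E' := by
  rw [labels_cons_iff]
  constructor
  · rintro ⟨a, M₁, E₁, M₂, E₂, h₁, h₂, rfl, rfl⟩
    obtain ⟨rfl, rfl⟩ := labels_nil_iff.1 h₁
    exact ⟨a, _, _, h₂, by simp, by simp⟩
  · rintro ⟨a, M', E', h, rfl, rfl⟩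
    exact ⟨a, 0, 0, M', E', .nil _, h, by simp, by simp⟩

/-- Two roots, one with four leaves and one with one leaf, both children of a new root. -/
abbrev doubleStar : PlaneForest := cons (cons (leaves 4) path₂) nil

/-- In a labeling of a leaf with label `a` below a vertex with label `x`, the leaf may be replaced
by `F`. -/
def Replaces (F : PlaneForest) (x a : ZMod 7) : Prop :=
  Labels F x (a ::ₘ allResidues) ((x + a) ::ₘ allResidues)

/-- The affine map taking 0 to `x` and 1 to `a` takes the weight 1 to `x + a`, so the single pair
(0, 1) decides all distinct pairs. -/
theorem replaces_of_solves {F : PlaneForest}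
    (h : solves F 0 (1 :: digits) (1 :: digits) = true) {x a : ZMod 7} (ha : a ≠ x) :
    Replaces F x a := by
  have hu := sub_ne_zero.2 ha
  have := (labels_of_solves h).affine (a - x) x
  simp only [residues_cons, residues_digits, Multiset.map_cons, map_allResidues hu, Nat.cast_one,
    Nat.cast_zero, mul_zero, zero_add, mul_one] at this
  unfold Replaces
  convert this using 2 <;> ring

theorem replaces_self_of_solves {F : PlaneForest}
    (h : solves F 0 (0 :: digits) (0 :: digits) = true) (x : ZMod 7) : Replaces F x x := by
  have := (labels_of_solves h).affine 1 x
  simp only [residues_cons, residues_digits, Multiset.map_cons, Nat.cast_zero, mul_zero, zero_add,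
    map_allResidues (u := 1) (by decide)] at this
  unfold Replaces
  convert this using 2
  ring

theorem replaces_doubleStar {x a : ZMod 7} (h : a ≠ x) : Replaces doubleStar x a :=
  replaces_of_solves (by decide +kernel) h

theorem replaces_exceptional {F : PlaneForest} (hF : F ∈ exceptional)
    (h : F ≠ cons (leaves 4) path₂) (x a : ZMod 7) : Replaces (cons F nil) x a := by
  have h₀ : ∀ F ∈ exceptional, F ≠ cons (leaves 4) path₂ →
      solves (cons F nil) 0 (0 :: digits) (0 :: digits) = true := by decide +kernel
  have h₁ : ∀ F ∈ exceptional, F ≠ cons (leaves 4) path₂ →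
      solves (cons F nil) 0 (1 :: digits) (1 :: digits) = true := by decide +kernel
  rcases eq_or_ne a x with rfl | ha
  · exact replaces_self_of_solves (h₀ F hF h) a
  · exact replaces_of_solves (h₁ F hF h) ha

theorem Reducible.of_replaces {F : PlaneForest} (h : ∀ x a, Replaces (cons F nil) x a)
    (hF : 0 < F.size) (R : PlaneForest) : Reducible (cons F R) := by
  refine ⟨cons nil R, 1, by simp only [size]; omega, fun x M E h' => ?_⟩
  obtain ⟨a, M', E', hR, rfl, rfl⟩ := labels_nil_cons_iff.1 h'
  refine Labels.append_of_eq (h x a) hR ?_ ?_ <;>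
    · simp only [← Multiset.singleton_add]; abel

theorem labels_doubleStar_leaf (x : ZMod 7) : Labels (doubleStar.append (leaves 1)) x
    (x ::ₘ x ::ₘ allResidues) ((x + x) ::ₘ (x + x) ::ₘ allResidues) := by
  have h : solves (doubleStar.append (leaves 1)) 0 (0 :: 0 :: digits) (0 :: 0 :: digits) = true := by
    decide +kernel
  have := (labels_of_solves h).affine 1 x
  simp only [residues_cons, residues_digits, Multiset.map_cons, Nat.cast_zero, mul_zero, zero_add,
    map_allResidues (u := 1) (by decide)] at this
  simpa only [two_mul] using this

/-- The smaller forest has two leaves in place of the double star and its neighbor. If one is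
labeled differently from the attaching vertex, the double star replaces it; otherwise both labels
equal `x`, and one joint labeling settles this. -/
theorem reducible_doubleStar_leaf (R : PlaneForest) :
    Reducible (doubleStar.append (cons nil R)) := by
  refine ⟨cons nil (cons nil R), 1, by simp [size, append, leaves], fun x M E h₁ => ?_⟩
  obtain ⟨a, _, _, h₂, rfl, rfl⟩ := labels_nil_cons_iff.1 h₁
  obtain ⟨b, M, E, hR, rfl, rfl⟩ := labels_nil_cons_iff.1 h₂
  rcases eq_or_ne a x with rfl | ha
  · rcases eq_or_ne b a with rfl | hb
    · refine Labels.append_of_eq (F := doubleStar.append (leaves 1))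
        (labels_doubleStar_leaf b) hR ?_ ?_ <;>
        · simp only [← Multiset.singleton_add]; abel
    · refine Labels.append_of_eq (replaces_doubleStar hb)
        (labels_nil_cons_iff.2 ⟨a, _, _, hR, rfl, rfl⟩) ?_ ?_ <;>
        · simp only [← Multiset.singleton_add]; abel
  · refine Labels.append_of_eq (replaces_doubleStar ha)
      (labels_nil_cons_iff.2 ⟨b, _, _, hR, rfl, rfl⟩) ?_ ?_ <;>
      · simp only [← Multiset.singleton_add]; abel

/-- Translation brings `x` to 0, which leaves 49 pairs to search. This is the case of a replaced
leaf labeled `x`, with the neighboring path labeled `p`, `q`. -/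
theorem labels_doubleStar_path₂ (x p q : ZMod 7) : Labels (doubleStar.append path₂) x
    (x ::ₘ p ::ₘ q ::ₘ allResidues)
    ((x + x) ::ₘ (x + p) ::ₘ (p + q) ::ₘ allResidues) := by
  have h : ∀ p ∈ List.range 7, ∀ q ∈ List.range 7, solves (doubleStar.append path₂) 0
      (0 :: p :: q :: digits) (0 :: p :: ((p + q) % 7) :: digits) = true := by
    decide +kernel
  have := (labels_of_solves (h (p - x).val (List.mem_range.2 (ZMod.val_lt _)) (q - x).val
    (List.mem_range.2 (ZMod.val_lt _)))).affine 1 x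
  have e₁ : p - x + 2 * x = x + p := by ring
  have e₂ : p - x + (q - x) + 2 * x = p + q := by ring
  simp only [residues_cons, residues_digits, Multiset.map_cons, Nat.cast_zero, mul_zero, zero_add,
    ZMod.natCast_mod, Nat.cast_add, ZMod.natCast_val,
    ZMod.cast_id', id_eq, one_mul, sub_add_cancel, e₁, e₂] at this
  have h₁ := map_allResidues (u := 1) (by decide)
  simp only [one_mul] at h₁
  simpa only [two_mul, h₁] using this

theorem reducible_doubleStar_path₂ (R : PlaneForest) :
    Reducible (doubleStar.append (cons (leaves 1) R)) := by
  refine ⟨cons nil (cons (leaves 1) R), 1, by simp [size, append, leaves], fun x M E h₁ => ?_⟩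
  obtain ⟨a, _, _, h₂, rfl, rfl⟩ := labels_nil_cons_iff.1 h₁
  rcases eq_or_ne a x with rfl | ha
  · obtain ⟨p, _, _, M, E, h₃, hR, rfl, rfl⟩ := labels_cons_iff.1 h₂
    obtain ⟨q, _, _, h₄, rfl, rfl⟩ := labels_nil_cons_iff.1 h₃
    obtain ⟨rfl, rfl⟩ := labels_nil_iff.1 h₄
    refine Labels.append_of_eq (F := doubleStar.append path₂)
      (labels_doubleStar_path₂ a p q) hR ?_ ?_ <;>
      · simp only [← Multiset.singleton_add]; abel
  · refine Labels.append_of_eq (replaces_doubleStar ha) h₂ ?_ ?_ <;>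
      · simp only [← Multiset.singleton_add]; abel

theorem labels_doubleStar_doubleStar (x b : ZMod 7) : Labels (doubleStar.append doubleStar) x
    -- The label lists below are two copies of the residues besides the two extra labels; their
    -- order affects only the search.
    (x ::ₘ b ::ₘ (2 • allResidues)) ((x + x) ::ₘ (x + b) ::ₘ (2 • allResidues)) := by
  have h₀ : solves (doubleStar.append doubleStar) 0
      (0 :: 0 :: [0, 1, 2, 3, 4, 5, 6, 5, 0, 1, 2, 3, 6, 4])
      (0 :: 0 :: (digits ++ digits)) = true := by
    decide +kernel
  have h₁ : solves (doubleStar.append doubleStar) 0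
      (0 :: 1 :: [0, 1, 2, 3, 4, 6, 0, 1, 5, 4, 5, 6, 2, 3])
      (0 :: 1 :: (digits ++ digits)) = true := by
    decide +kernel
  have e : residues (digits ++ digits) = 2 • allResidues := by decide
  have e₀ : residues [0, 1, 2, 3, 4, 5, 6, 5, 0, 1, 2, 3, 6, 4] = 2 • allResidues := by decide
  have e₁ : residues [0, 1, 2, 3, 4, 6, 0, 1, 5, 4, 5, 6, 2, 3] = 2 • allResidues := by decide
  rcases eq_or_ne b x with rfl | hb
  · have := (labels_of_solves h₀).affine 1 b
    simp only [residues_cons, e, e₀, Multiset.map_cons, Nat.cast_zero, mul_zero, zero_add,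
      Multiset.map_nsmul, map_allResidues (u := 1) (by decide)] at this
    simpa only [two_mul] using this
  · have hu := sub_ne_zero.2 hb
    have := (labels_of_solves h₁).affine (b - x) x
    simp only [residues_cons, e, e₁, Multiset.map_cons, Nat.cast_zero, mul_zero, zero_add,
      Multiset.map_nsmul, map_allResidues hu, Nat.cast_one, mul_one] at this
    convert this using 3 <;> ring

theorem reducible_doubleStar_doubleStar (R : PlaneForest) :
    Reducible (doubleStar.append (doubleStar.append R)) := by
  refine ⟨cons nil (cons nil R), 2, by simp only [size, append, leaves]; omega,
    fun x M E h₁ => ?_⟩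
  obtain ⟨a, _, _, h₂, rfl, rfl⟩ := labels_nil_cons_iff.1 h₁
  obtain ⟨b, M, E, hR, rfl, rfl⟩ := labels_nil_cons_iff.1 h₂
  rcases eq_or_ne a x with rfl | ha
  · refine Labels.append_of_eq (F := doubleStar.append doubleStar)
      (labels_doubleStar_doubleStar a b) hR ?_ ?_ <;>
      · simp only [← Multiset.singleton_add]; abel
  rcases eq_or_ne b x with rfl | hb
  · refine Labels.append_of_eq (F := doubleStar.append doubleStar)
      (labels_doubleStar_doubleStar b a) hR ?_ ?_ <;>
      · simp only [← Multiset.singleton_add]; abel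
  · refine Labels.append_of_eq (replaces_doubleStar ha) ((replaces_doubleStar hb).append hR)
      ?_ ?_ <;>
      · simp only [← Multiset.singleton_add]; abel

theorem labels_cons_doubleStar (x p : ZMod 7) : Labels (cons doubleStar nil) x
    (p ::ₘ p ::ₘ allResidues) ((x + p) ::ₘ (p + p) ::ₘ allResidues) := by
  have h₀ : solves (cons doubleStar nil) 0 [1, 4, 0, 0, 0, 3, 6, 5, 2]
      (0 :: 0 :: digits) = true := by
    decide +kernel
  have h₁ : solves (cons doubleStar nil) 0 [0, 1, 1, 1, 3, 4, 5, 2, 6]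
      (1 :: 2 :: digits) = true := by
    decide +kernel
  have e₀ : residues [1, 4, 0, 0, 0, 3, 6, 5, 2] = 0 ::ₘ 0 ::ₘ allResidues := by decide
  have e₁ : residues [0, 1, 1, 1, 3, 4, 5, 2, 6] = 1 ::ₘ 1 ::ₘ allResidues := by decide
  rcases eq_or_ne p x with rfl | hp
  · have := (labels_of_solves h₀).affine 1 p
    simp only [e₀, residues_cons, residues_digits, Multiset.map_cons, Nat.cast_zero, mul_zero,
      zero_add, map_allResidues (u := 1) (by decide)] at this
    simpa only [two_mul] using this
  · have hu := sub_ne_zero.2 hp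
    have := (labels_of_solves h₁).affine (p - x) x
    simp only [e₁, residues_cons, residues_digits, Multiset.map_cons, Nat.cast_zero, mul_zero,
      zero_add, map_allResidues hu, Nat.cast_one, mul_one, sub_add_cancel] at this
    have e₃ : p - x + 2 * x = x + p := by ring
    have e₄ : (p - x) * (2 : ℕ) + 2 * x = p + p := by push_cast; ring
    simpa only [e₃, e₄] using this

/-- In the smaller forest the double star shrinks to a leaf labeled `q` below a vertex labeled `p`.
If `q = p`, the vertex above the double star is relabeled along with it. -/
theorem reducible_cons_doubleStar (R : PlaneForest) : Reducible (cons doubleStar R) := by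
  refine ⟨cons (leaves 1) R, 1, by simp [size, leaves], fun x M E h₁ => ?_⟩
  obtain ⟨p, _, _, M, E, h₂, hR, rfl, rfl⟩ := labels_cons_iff.1 h₁
  obtain ⟨q, _, _, h₃, rfl, rfl⟩ := labels_nil_cons_iff.1 h₂
  obtain ⟨rfl, rfl⟩ := labels_nil_iff.1 h₃
  rcases eq_or_ne q p with rfl | hq
  · refine Labels.append_of_eq (labels_cons_doubleStar x q) hR ?_ ?_ <;>
      · simp only [← Multiset.singleton_add]; abel
  · refine .cons_of_eq p (replaces_doubleStar hq) hR ?_ ?_ <;>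
      · simp only [← Multiset.singleton_add]; abel

/-- Used with `n + m = 4`: the larger star of the double star lends `n` of its leaves. -/
theorem attaches_doubleStar (n m : ℕ) (R : PlaneForest) : Attaches (leaves n)
    (cons (leaves m) R) (cons ((leaves n).append (leaves m)) R) :=
  (Attaches.append _ _).left R

/-- For `D` of size two to five, the larger star lends the leaves that complete the next tree to
seven vertices. Sizes six and seven reduce without the double star, unless the next tree is a double
star too. Sizes zero and one use joint labelings. -/
theorem reducible_doubleStar_cons {D R : PlaneForest} (hD : D.sorted = true) (h : D.size ≤ 7) :
    Reducible (doubleStar.append (cons D R)) := by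
  obtain h | h | h | h | h | h | h | h : D.size = 7 ∨ D.size = 6 ∨ D.size = 5 ∨ D.size = 4 ∨
    D.size = 3 ∨ D.size = 2 ∨ D.size = 1 ∨ D.size = 0 := by omega
  · rcases full_of_size_eq_seven hD h with he | hf
    · by_cases hl : D = cons (leaves 4) path₂
      · subst hl
        exact reducible_doubleStar_doubleStar R
      · exact (Reducible.of_replaces (replaces_exceptional he hl) (by omega) R).right _
    · have := Reducible.of_full hf (by omega) nil
      have e : D.append nil = D := by
        clear * -
        induction D with
        | nil => rfl
        | cons C R _ ih => rw [append, ih]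
      rw [e] at this
      exact (this.left R).right _
  · exact (reducible_of_prefix (A := cons D nil) (sorted_cons_nil.2 hD) (by simp [size, h])
      (not_mem_exceptional_of_rootSizes (by simp [rootSizes]) (by simp [rootSizes])
        (by simp [rootSizes])) R).right _
  · exact .of_full₂_left (A := cons D nil) (full₂_leaf (sorted_cons_nil.2 hD)
      (by simp [size, h]) (cons_ne_leaves (by omega) _) (by simp)) (by simp [size])
      (attaches_doubleStar 1 3 _) R
  · exact .of_full₂_left (A := cons D nil) (full₂_leaves_two (sorted_cons_nil.2 hD)
      (by simp [size, h]) (cons_ne_leaves (by omega) _)) (by simp [size])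
      (attaches_doubleStar 2 2 _) R
  · exact .of_full₂_left (A := cons D nil) (full₂_leaves_three (sorted_cons_nil.2 hD)
      (by simp [size, h]) (cons_ne_leaves (by omega) _)) (by simp [size])
      (attaches_doubleStar 3 1 _) R
  · exact .of_full₂_left (A := cons D nil) (full₂_leaves_four hD h) (by simp [size])
      (attaches_doubleStar 4 0 _) R
  · rw [eq_leaves_one h]
    exact reducible_doubleStar_path₂ R
  · rw [eq_nil_of_size_eq_zero h]
    exact reducible_doubleStar_leaf R

/-- Induction into the first, largest tree: as long as at least seven vertices lie below its root, a
reduction there suffices, and an irreducible forest there is one of five known shapes. Otherwise all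
trees are small. -/
theorem reducible_or_exceptional {F : PlaneForest} (hF : F.sorted = true) (h : 7 ≤ F.size) :
    Reducible F ∨ F ∈ exceptional ∨ F = doubleStar := by
  induction F with
  | nil => simp [size] at h
  | cons C R ihC _ =>
    have hC := sorted_left hF
    rcases le_or_gt 7 C.size with h7 | h7
    · obtain h' | he | rfl := ihC hC h7
      · exact .inl (h'.left R)
      · by_cases hl : C = cons (leaves 4) path₂
        · subst hl
          cases R with
          | nil => exact .inr (.inr rfl)
          | cons D R =>
            rw [sorted_cons_cons] at hF
            exact .inl (reducible_doubleStar_cons (sorted_left hF.2.1) hF.2.2)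
        · exact .inl (.of_replaces (replaces_exceptional he hl) (by omega) R)
      · exact .inl (reducible_cons_doubleStar R)
    rcases (show C.size ≤ 6 by omega).eq_or_lt with h6 | h6
    · exact .inl (reducible_of_prefix (A := cons C nil) (sorted_cons_nil.2 hC) (by simp [size, h6])
        (not_mem_exceptional_of_rootSizes (by simp [rootSizes]) (by simp [rootSizes])
        (by simp [rootSizes])) R)
    rcases h.eq_or_lt with h | h
    · rcases full_of_size_eq_seven hF h.symm with he | hf
      · exact .inr (.inl he)
      · refine .inl ⟨nil, 1, by simp only [size]; omega, fun x M E h' => ?_⟩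
        obtain ⟨rfl, rfl⟩ := labels_nil_iff.1 h'
        simpa using hf x
    · exact .inl (reducible_of_size_le_five hF (by omega) h)

/-! ### Balanced labelings of all forests. -/

/-- The multiplicities of the residues differ by at most one. -/
def Balanced (M : Multiset (ZMod 7)) : Prop := ∀ a b, M.count a ≤ M.count b + 1

instance (M : Multiset (ZMod 7)) : Decidable (Balanced M) := by unfold Balanced; infer_instance

theorem Balanced.add_nsmul {M : Multiset (ZMod 7)} (h : Balanced M) (n : ℕ) :
    Balanced (M + n • allResidues) := fun a b => by
  have e : ∀ c, allResidues.count c = 1 := by decide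
  have := h a b
  simp only [Multiset.count_add, Multiset.count_nsmul, e]
  omega

theorem Balanced.of_le {M : Multiset (ZMod 7)} (h : M ≤ allResidues) : Balanced M := fun a b => by
  have := Multiset.nodup_iff_count_le_one.1 (Multiset.nodup_of_le h Finset.univ.nodup) a
  omega

theorem exists_balanced_of_exceptional {F : PlaneForest} (h : F ∈ exceptional ∨ F = doubleStar) :
    ∃ M E, Labels F 0 M E ∧ Balanced (0 ::ₘ M) ∧ Balanced E := by
  rcases h with h | rfl
  -- With the root labeled 0 there are eight vertices, so one label, here 1, must repeat.
  · have : ∀ F ∈ exceptional, solves F 0 [1, 1, 2, 3, 4, 5, 6] digits = true := by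
      decide +kernel
    exact ⟨_, _, labels_of_solves (this F h), by decide, by decide⟩
  -- Nine vertices with the root and eight edges: the labels 0 and 1 and the weight 0 occur twice.
  · have : solves doubleStar 0 [0, 1, 1, 2, 3, 4, 5, 6] (0 :: digits) = true := by
      decide +kernel
    exact ⟨_, _, labels_of_solves this, by decide, by decide⟩

theorem exists_balanced (F : PlaneForest) :
    ∃ M E, Labels F 0 M E ∧ Balanced (0 ::ₘ M) ∧ Balanced E := by
  induction hn : F.size using Nat.strong_induction_on generalizing F with
  | _ n ih =>
    subst hn
    obtain ⟨G, hG, hGF⟩ := exists_sorted F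
    suffices ∃ M E, Labels G 0 M E ∧ Balanced (0 ::ₘ M) ∧ Balanced E by
      obtain ⟨M, E, h, hM, hE⟩ := this
      exact ⟨M, E, hGF.2 h, hM, hE⟩
    rcases le_or_gt G.size 6 with h6 | h6
    · obtain ⟨M, E, h, hM, hE⟩ := exists_labels_of_size_le_six hG h6
      exact ⟨M, E, h, .of_le hM, .of_le hE⟩
    · rcases reducible_or_exceptional hG h6 with ⟨F', n, hs, h⟩ | h
      · obtain ⟨M, E, h', hM, hE⟩ := ih _ (hGF.1 ▸ hs) F' rfl
        exact ⟨_, _, h _ _ _ h', by rw [← Multiset.cons_add]; exact hM.add_nsmul n, hE.add_nsmul n⟩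
      · exact exists_balanced_of_exceptional h

end PlaneForest

open PlaneForest

/-! ### From graph-theoretic trees to plane forests. -/

/-- With respect to the parent function `p`, the vertices in `S` form a forest of shape `F` whose
roots are children of `v`. -/
inductive Hangs {V : Type*} [DecidableEq V] (p : V → V) : V → PlaneForest → Finset V → Prop
  | nil (v : V) : Hangs p v .nil ∅
  | cons {v c : V} {C R : PlaneForest} {S S' : Finset V} : p c = v → Hangs p c C S →
      Hangs p v R S' → c ∉ S → c ∉ S' → Disjoint S S' →
      Hangs p v (.cons C R) (insert c (S ∪ S'))

section Hangs

variable {V : Type*} [DecidableEq V] {p : V → V}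

/-- A new leaf may be added below any vertex. -/
theorem Hangs.exists_insert {v : V} {F : PlaneForest} {S : Finset V} (h : Hangs p v F S)
    {l : V} (hl : l ∉ insert v S) (hp : p l ∈ insert v S) : ∃ F', Hangs p v F' (insert l S) := by
  have add_root : ∀ {v : V} {F : PlaneForest} {S : Finset V}, Hangs p v F S → l ∉ S → p l = v →
      ∃ F', Hangs p v F' (insert l S) := fun {v F S} h hl hp => by
    have := Hangs.cons hp (.nil l) h (Finset.notMem_empty l) hl (Finset.disjoint_empty_left S)
    rw [Finset.empty_union] at this
    exact ⟨_, this⟩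
  induction h with
  | nil v => exact add_root (.nil v) (Finset.notMem_empty l) (by simpa using hp)
  | @cons v c C R S S' hc hC hR hcS hcS' hd ihC ihR =>
    simp only [Finset.mem_insert, Finset.mem_union, not_or] at hl hp ihC ihR
    obtain ⟨hlv, hlc, hlS, hlS'⟩ := hl
    by_cases hv : p l = v
    · exact add_root (.cons hc hC hR hcS hcS' hd) (by simp [hlc, hlS, hlS']) hv
    by_cases hpC : p l = c ∨ p l ∈ S
    · obtain ⟨C', hC'⟩ := ihC ⟨hlc, hlS⟩ hpC
      have := Hangs.cons hc hC' hR (by simp [hcS, Ne.symm hlc]) hcS' (by simp [hlS', hd])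
      rw [Finset.insert_union, Finset.insert_comm] at this
      exact ⟨_, this⟩
    · obtain ⟨R', hR'⟩ := ihR ⟨hlv, hlS'⟩ (by tauto)
      have := Hangs.cons hc hC hR' hcS (by simp [hcS', Ne.symm hlc]) (by simp [hlS, hd])
      rw [Finset.union_insert, Finset.insert_comm] at this
      exact ⟨_, this⟩

/-- Ensures that relabeling vertices outside `insert v S` leaves the weights on `S` unchanged. -/
theorem Hangs.parent_mem {v : V} {F : PlaneForest} {S : Finset V} (h : Hangs p v F S) :
    ∀ w ∈ S, p w ∈ insert v S := by
  induction h with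
  | nil v => simp
  | cons hc _ _ _ _ _ ihC ihR =>
    simp only [Finset.mem_insert, Finset.mem_union] at ihC ihR ⊢
    rintro w (rfl | hw | hw)
    · exact .inl hc
    · have := ihC w hw; tauto
    · have := ihR w hw; tauto

/-- Labelings of the shape give labelings of the vertices. -/
theorem Hangs.exists_labeling {v : V} {F : PlaneForest} {S : Finset V} (h : Hangs p v F S)
    (hv : v ∉ S) (f : V → ZMod 7) {M E : Multiset (ZMod 7)} (hL : Labels F (f v) M E) :
    ∃ g : V → ZMod 7, (∀ w ∉ S, g w = f w) ∧ S.val.map g = M ∧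
      (S.val.map fun w => g (p w) + g w) = E := by
  induction h generalizing f M E with
  | nil v =>
    obtain ⟨rfl, rfl⟩ := labels_nil_iff.1 hL
    exact ⟨f, fun _ _ => rfl, rfl, rfl⟩
  | @cons v c C R S S' hc hC hR hcS hcS' hd ihC ihR =>
    simp only [Finset.mem_insert, Finset.mem_union, not_or] at hv
    obtain ⟨hvc, hvS, hvS'⟩ := hv
    obtain ⟨a, M₁, E₁, M₂, E₂, h₁, h₂, rfl, rfl⟩ := labels_cons_iff.1 hL
    obtain ⟨g, hg, hgM, hgE⟩ := ihC hcS (Function.update f c a) (by simpa using h₁)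
    have hgv : g v = f v := by rw [hg v hvS, Function.update_of_ne hvc]
    obtain ⟨g', hg', hgM', hgE'⟩ := ihR hvS' g (hgv ▸ h₂)
    have hgc : g' c = a := by rw [hg' c hcS', hg c hcS, Function.update_self]
    have hgS : ∀ w ∈ insert c S, g' w = g w := fun w hw => hg' w (by
      rcases Finset.mem_insert.1 hw with rfl | hw
      exacts [hcS', Finset.disjoint_left.1 hd hw])
    have hval : (insert c (S ∪ S')).val = c ::ₘ (S.val + S'.val) := by
      rw [Finset.insert_val_of_notMem (by simp [hcS, hcS']), ← Finset.disjUnion_eq_union _ _ hd]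
      rfl
    refine ⟨g', fun w hw => ?_, ?_, ?_⟩
    · simp only [Finset.mem_insert, Finset.mem_union, not_or] at hw
      rw [hg' w hw.2.2, hg w hw.2.1, Function.update_of_ne hw.1]
    · rw [hval, Multiset.map_cons, Multiset.map_add, hgc, hgM', ← hgM]
      congr 2
      exact Multiset.map_congr rfl fun w hw => hgS w (Finset.mem_insert_of_mem hw)
    · rw [hval, Multiset.map_cons, Multiset.map_add, hgE', ← hgE, hc, hgc, hg' v hvS', hgv]
      congr 2
      refine Multiset.map_congr rfl fun w hw => ?_
      rw [hgS w (Finset.mem_insert_of_mem hw), hgS _ (hC.parent_mem w hw)]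

end Hangs

/-- If a potential decreases from each vertex but `r` to its parent, then all vertices but `r` form
a forest below `r`. -/
theorem exists_hangs {V : Type*} [Fintype V] [DecidableEq V] {p : V → V} {r : V} (d : V → ℕ)
    (hd : ∀ v, v ≠ r → d (p v) < d v) : ∃ F, Hangs p r F (Finset.univ.erase r) := by
  suffices ∀ n, ∀ S : Finset V, r ∉ S → (Finset.univ \ insert r S).card = n →
      (∃ F, Hangs p r F S) → ∃ F, Hangs p r F (Finset.univ.erase r) from
    this _ ∅ (Finset.notMem_empty r) rfl ⟨_, .nil r⟩
  intro n
  induction n with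
  | zero =>
    intro S hr hS h
    rw [Finset.card_eq_zero, Finset.sdiff_eq_empty_iff_subset] at hS
    rwa [← Finset.erase_insert hr, Finset.Subset.antisymm (Finset.subset_univ _) hS] at h
  | succ n ih =>
    rintro S hr hS ⟨F, h⟩
    -- A vertex of least potential among those not yet placed has its parent already placed.
    obtain ⟨l, hl, hmin⟩ := Finset.exists_min_image (Finset.univ \ insert r S) d
      (Finset.card_pos.1 (by omega))
    have hlS := (Finset.mem_sdiff.1 hl).2
    have hlr : l ≠ r := fun e => hlS (by simp [e])
    have hp : p l ∈ insert r S := by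
      by_contra hp
      exact absurd (hmin _ (Finset.mem_sdiff.2 ⟨Finset.mem_univ _, hp⟩)) (not_le.2 (hd l hlr))
    refine ih (insert l S) ?_ ?_ (h.exists_insert hlS hp)
    · simp [Ne.symm hlr, hr]
    · have : Finset.univ \ insert r (insert l S) = (Finset.univ \ insert r S).erase l := by
        ext
        simp only [Finset.mem_sdiff, Finset.mem_erase, Finset.mem_univ, Finset.mem_insert]
        tauto
      rw [this, Finset.card_erase_of_mem hl, hS, Nat.add_sub_cancel]

/-- A tree has a parent function towards any vertex `r`. -/
theorem SimpleGraph.IsTree.exists_parent {V : Type*} [Fintype V] [DecidableEq V]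
    {T : SimpleGraph V} (hT : T.IsTree) (r : V) : ∃ p : V → V,
      (∀ v, v ≠ r → T.dist r (p v) < T.dist r v) ∧
      Set.InjOn (fun v => s(p v, v)) {v | v ≠ r} ∧
      T.edgeSet = (fun v => s(p v, v)) '' {v | v ≠ r} := by
  classical
  have h : ∀ v, ∃ u, v ≠ r → T.Adj u v ∧ T.dist r u < T.dist r v := fun v => by
    -- The parent is the second vertex on a shortest walk to `r`; at `r` the value is arbitrary.
    obtain ⟨w, hw⟩ := hT.connected.exists_walk_length_eq_dist v r
    cases w with
    | nil => exact ⟨r, fun h => absurd rfl h⟩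
    | @cons _ u _ ha w =>
      refine ⟨u, fun _ => ⟨ha.symm, ?_⟩⟩
      have := T.dist_le w
      rw [SimpleGraph.Walk.length_cons] at hw
      rw [T.dist_comm, T.dist_comm (u := r)]
      omega
  choose p hp using h
  have inj : Set.InjOn (fun v => s(p v, v)) {v | v ≠ r} := by
    intro v hv w hw e
    rcases Sym2.eq_iff.1 e with ⟨-, e⟩ | ⟨e₁, e₂⟩
    · exact e
    -- Two vertices that were each other's parent would each be closer to `r` than the other.
    · have h₁ := (hp v hv).2
      have h₂ := (hp w hw).2
      rw [e₁] at h₁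
      rw [← e₂] at h₂
      omega
  refine ⟨p, fun v hv => (hp v hv).2, inj, ?_⟩
  have hsub : (Finset.univ.erase r).image (fun v => s(p v, v)) ⊆ T.edgeFinset := by
    intro e he
    obtain ⟨v, hv, rfl⟩ := Finset.mem_image.1 he
    exact SimpleGraph.mem_edgeFinset.2 (hp v (Finset.ne_of_mem_erase hv)).1
  -- A tree has one edge fewer than vertices, so the injective parent edges exhaust the edge set.
  have hcard : T.edgeFinset.card ≤ ((Finset.univ.erase r).image fun v => s(p v, v)).card := by
    rw [Finset.card_image_of_injOn (inj.mono fun v hv => Finset.ne_of_mem_erase hv),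
      Finset.card_erase_of_mem (Finset.mem_univ r), Finset.card_univ, ← hT.card_edgeFinset]
    simp
  have := Finset.eq_of_subset_of_card_le hsub hcard
  rw [← SimpleGraph.coe_edgeFinset, ← this]
  ext; simp

theorem theorem3p1 {V : Type*} [Finite V] (T : SimpleGraph V) (hT : T.IsTree) :
    IsCordial 7 T := by
  classical
  have := Fintype.ofFinite V
  obtain ⟨r⟩ := hT.connected.nonempty
  obtain ⟨p, hd, hinj, hedge⟩ := hT.exists_parent r
  obtain ⟨F, hF⟩ := exists_hangs _ hd
  obtain ⟨M, E, hL, hM, hE⟩ := PlaneForest.exists_balanced F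
  -- Only the value at `r` survives from the zero function; it is the extra 0 in the balanced
  -- multiset of labels.
  obtain ⟨f, hfr, rfl, rfl⟩ := hF.exists_labeling (Finset.notMem_erase r _) (fun _ => 0) hL
  have hv : ∀ a, vertexCount f a = (0 ::ₘ (Finset.univ.erase r).val.map f).count a := fun a => by
    rw [← hfr r (Finset.notMem_erase r _), ← Multiset.map_cons,
      ← Finset.insert_val_of_notMem (Finset.notMem_erase r _),
      Finset.insert_erase (Finset.mem_univ r), Multiset.count_map, ← Finset.filter_val,
      Finset.card_val, vertexCount, Set.ncard_eq_toFinset_card']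
    congr 1
    ext
    simp [eq_comm]
  have he : ∀ a, edgeCount T f a =
      ((Finset.univ.erase r).val.map fun v => f (p v) + f v).count a := fun a => by
    have : {e : Sym2 V | e ∈ T.edgeSet ∧ edgeWeight f e = a} =
        (fun v => s(p v, v)) '' {v | v ≠ r ∧ f (p v) + f v = a} := by
      rw [hedge]
      ext e
      constructor
      · rintro ⟨⟨v, hv, rfl⟩, h⟩
        exact ⟨v, ⟨hv, h⟩, rfl⟩
      · rintro ⟨v, ⟨hv, h⟩, rfl⟩
        exact ⟨⟨v, hv, rfl⟩, h⟩
    rw [edgeCount, this, (hinj.mono fun v hv => hv.1).ncard_image,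
      Multiset.count_map, ← Finset.filter_val, Finset.card_val, Set.ncard_eq_toFinset_card']
    congr 1
    ext
    simp [eq_comm]
  refine ⟨f, fun a b => ?_, fun a b => ?_⟩
  · have h₁ := hM a b
    have h₂ := hM b a
    rw [← hv, ← hv] at h₁ h₂
    rw [abs_le]
    omega
  · have h₁ := hE a b
    have h₂ := hE b a
    rw [← he, ← he] at h₁ h₂
    rw [abs_le]
    omega
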